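/- \textbf{Setting.} There are $N$ agents and $M$ divisible resources. A profile is $y=(v,x,b)$ with values $v\in\mathcal V\subseteq[\underline v,\overline v]^{NM}$, demands $x\in\mathcal D\subseteq[\underline d,\overline d]^{NM}$ and budgets $b\in\mathcal B\subseteq[0,\overline b]^M$, where $\underline v,\underline d>0$. Agents have fixed weights $w_i\in[0,\overline w]$. The feasible allocations are $\mathcal A_{b,x}=\{a\in\mathbb R^{NM}:0\le a_{i,m}\le x_{i,m},\ \sum_i a_{i,m}\le b_m\}$, and $u_i(a,v,x)=\sum_m v_{i,m}\min\{a_{i,m},x_{i,m}\}$. For a mechanism $f$, mapping each profile $(v,x,b)$ to an element of $\mathcal A_{b,x}$, put $$\mathbf{logNSW}(f,v,x,b)=\log\prod_i u_i(f(v,x,b),v,x)^{w_i},$$ $$\mathbf{expl}_i(f,v,x,b)=\sup_{v_i',x_i'}u_i\big(f((v_i',v_{-i}),(x_i',x_{-i}),b),v,x\big)-u_i\big(f(v,x,b),v,x\big),$$ the supremum being over all $v_i',x_i'$ with $(v_i',v_{-i})\in\mathcal V$ and $(x_i',x_{-i})\in\mathcal D$. \textbf{RPF-Net.} Let $z_\omega:\mathbb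 R^{2NM+M}\to\mathbb R^{NM}$ be the fully connected feed-forward network with $R\ge1$ hidden layers of $K\ge1$ ReLU nodes each and an affine output layer, $\omega\in\mathbb R^d$ being the vector of all its weights and biases. The mechanism is $f_\omega(y)=\phi(y,z_\omega(y))$, where the activation $\phi(y,z)$ is a selected solution of $$\min_{a\in\mathcal A_{b,x}}\ -\sum_i w_i\log(a_i^\top v_i)+\langle a,z\rangle .$$ \textbf{Assumptions.} Let $F$ be a probability distribution on $\mathcal V\times\mathcal D\times\mathcal B$, let $\Omega>0$, $\psi>1$ and $\Phi\ge1$. For $F$-almost every $y$, every agent $i$ and every $\omega$ with $\|\omega\|_1\le\Omega$ we have $1/\psi\le u_i(f_\omega(y),v,x)\le\psi$, and $\sum_{m\in S}v_{i,m}\le1$ for every set $S$ of resources. For each $y\in\mathcal V\times\mathcal D\times\mathcal B$ the activation $\phi(y,\cdot)$ is $\Phi$-Lipschitz in the $\ell^1$ norm on $\{z_\omega(y):\|\omega\|_1\le\Omega\}$. For $\|\omega\|_1\le\Omega$ the functions $\mathbf{logNSW}(f_\omega,\cdot)$ and $\mathbf{expl}_i(f_\omega,\cdot)$ are $F$-measurable.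 Finally $LN\Omega\Phi\max\{K,MN\}\ge2$. \textbf{Theorem (generalization bound).} For a sample $y^1,\dots,y^L$, $L\ge1$, let $$\varepsilon_{\mathbf{logNSW}}(f,L)=-\mathbb E_{y\sim F}[\mathbf{logNSW}(f,y)]+\frac1L\sum_{l=1}^L\mathbf{logNSW}(f,y^l),\qquad \varepsilon_{\mathbf{exp},i}(f,L)=\mathbb E_{y\sim F}[\mathbf{expl}_i(f,y)]-\frac1L\sum_{l=1}^L\mathbf{expl}_i(f,y^l).$$ There is a constant $C>0$, depending only on $\overline v,\overline d,\overline b,\overline w$, such that for every $\delta\in(0,1)$, with probability at least $1-\delta$ over the draw of $L$ i.i.d. profiles from $F$, for all $\omega$ with $\|\omega\|_1\le\Omega$ and all agents $i$, $$\max\{\varepsilon_{\mathbf{logNSW}}(f_\omega,L),\varepsilon_{\mathbf{exp},i}(f_\omega,L)\}\le C\left(\psi N\sqrt{\frac{Rd\log\big(LN\Omega\Phi\max\{K,MN\}\big)}{L}}+(1+\log\psi)\,N\sqrt{\frac{\log(1/\delta)}{L}}\right).$$ -/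

import Mathlib

open MeasureTheory

namespace RPFNet

noncomputable section

/-- Arrays indexed by `N` agents and `M` resources (allocations, values, demands). -/
abbrev Alloc (N M : ℕ) : Type := Fin N → Fin M → ℝ

/-- A profile `y = (v, x, b)`: values, demands, budgets. -/
abbrev Profile (N M : ℕ) : Type := Alloc N M × Alloc N M × (Fin M → ℝ)

/-- Valid allocations: nonnegative, below the demands, within the budgets. -/
def feasibleSet {N M : ℕ} (y : Profile N M) : Set (Alloc N M) :=
  {a | (∀ i m, 0 ≤ a i m ∧ a i m ≤ y.2.1 i m) ∧ ∀ m, ∑ i, a i m ≤ y.2.2 m}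

/-- Thresholded linear additive utility of agent `i`. -/
def utility {N M : ℕ} (a v x : Alloc N M) (i : Fin N) : ℝ :=
  ∑ m, v i m * min (a i m) (x i m)

/-- Nash social welfare of the mechanism `f` with agent weights `w`. -/
def NSW {N M : ℕ} (w : Fin N → ℝ) (f : Profile N M → Alloc N M) (y : Profile N M) : ℝ :=
  ∏ i, utility (f y) y.1 y.2.1 i ^ w i

def logNSW {N M : ℕ} (w : Fin N → ℝ) (f : Profile N M → Alloc N M) (y : Profile N M) : ℝ :=
  Real.log (NSW w f y)

/-- The profile in which agent `i` reports `(v', x')` and everybody else reports as in `y`. -/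
def misreport {N M : ℕ} (y : Profile N M) (i : Fin N) (v' x' : Fin M → ℝ) : Profile N M :=
  (Function.update y.1 i v', Function.update y.2.1 i x', y.2.2)

/-- Exploitability at agent `i`: the largest (supremal) gain in true utility over all
misreports that keep the reported values in `V` and the reported demands in `D`. -/
def expl {N M : ℕ} (V D : Set (Alloc N M)) (f : Profile N M → Alloc N M) (i : Fin N)
    (y : Profile N M) : ℝ :=
  sSup {t | ∃ v' x' : Fin M → ℝ, Function.update y.1 i v' ∈ V ∧ Function.update y.2.1 i x' ∈ D ∧
    t = utility (f (misreport y i v' x')) y.1 y.2.1 i} - utility (f y) y.1 y.2.1 i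

/-! ### The feed-forward ReLU network -/

/-- Coordinates of the network input `(v, x, b)`. -/
abbrev InputIdx (N M : ℕ) : Type := (Fin N × Fin M) ⊕ (Fin N × Fin M) ⊕ Fin M

def netInput {N M : ℕ} (y : Profile N M) : InputIdx N M → ℝ
  | Sum.inl p => y.1 p.1 p.2
  | Sum.inr (Sum.inl p) => y.2.1 p.1 p.2
  | Sum.inr (Sum.inr m) => y.2.2 m

/-- Coordinates of the parameter vector of a network with `R ≥ 1` hidden layers of `K` nodes:
first hidden layer, the `R - 1` further hidden layers, output layer. In every layer the index
`none` is the bias of a node and `some j` is its weight on the `j`-th incoming coordinate. -/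
abbrev ParamIdx (N M R K : ℕ) : Type :=
  (Fin K × Option (InputIdx N M)) ⊕ (Fin (R - 1) × Fin K × Option (Fin K)) ⊕
    ((Fin N × Fin M) × Option (Fin K))

/-- The total number `d` of parameters. -/
def numParams (N M R K : ℕ) : ℕ := Fintype.card (ParamIdx N M R K)

/-- One affine node: bias plus weighted sum of the incoming coordinates. -/
def affine {α : Type} [Fintype α] (W : Option α → ℝ) (h : α → ℝ) : ℝ :=
  W none + ∑ j, W (some j) * h j

/-- Output of the hidden layers, which are numbered `0, …, R - 1`. -/
def hidden {N M R K : ℕ} (ω : ParamIdx N M R K → ℝ) (y : Profile N M) : ℕ → Fin K → ℝ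
  | 0 => fun k => max 0 (affine (fun j => ω (Sum.inl (k, j))) (netInput y))
  | n + 1 => fun k =>
      if hn : n < R - 1 then
        max 0 (affine (fun j => ω (Sum.inr (Sum.inl (⟨n, hn⟩, k, j)))) (hidden ω y n))
      else 0

/-- The network `z_ω`. -/
def network {N M R K : ℕ} (ω : ParamIdx N M R K → ℝ) (y : Profile N M) : Alloc N M :=
  fun i m => affine (fun j => ω (Sum.inr (Sum.inr ((i, m), j)))) (hidden ω y (R - 1))

/-- Parameter vectors with `‖ω‖₁ ≤ Ω`. -/
def paramBall (N M R K : ℕ) (Ω : ℝ) : Set (ParamIdx N M R K → ℝ) :=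
  {ω | ∑ p, |ω p| ≤ Ω}

/-! ### The regularized proportional fairness activation -/

open Classical in
/-- `-∑ i, w i * log (a i ⬝ v i) + ⟨a, z⟩`, with value `+∞` where the logarithm of a
nonpositive number would occur with a nonzero weight. -/
def rpfObjective {N M : ℕ} (w : Fin N → ℝ) (v z a : Alloc N M) : EReal :=
  if ∀ i, w i ≠ 0 → 0 < ∑ m, a i m * v i m then
    ((-(∑ i, w i * Real.log (∑ m, a i m * v i m)) + ∑ i, ∑ m, a i m * z i m : ℝ) : EReal)
  else ⊤

/-- `act y z` is, for each profile `y` in `Y`, a solution of the regularized proportional fairness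
program with linear regularizer `z` (the program can have several solutions; `act` selects one). -/
def IsRPFActivation {N M : ℕ} (w : Fin N → ℝ) (Y : Set (Profile N M))
    (act : Profile N M → Alloc N M → Alloc N M) : Prop :=
  ∀ y ∈ Y, ∀ z, act y z ∈ feasibleSet y ∧ IsMinOn (rpfObjective w y.1 z) (feasibleSet y) (act y z)

/-- The mechanism `f_ω`: the activation applied to the network output. -/
def rpfMechanism {N M R K : ℕ} (act : Profile N M → Alloc N M → Alloc N M)
    (ω : ParamIdx N M R K → ℝ) (y : Profile N M) : Alloc N M :=
  act y (network ω y)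

/-- On the outputs of networks with `‖ω‖₁ ≤ Ω`, the activation is `Φ`-Lipschitz for `ℓ¹` norms. -/
def LipschitzActivation {N M : ℕ} (R K : ℕ) (Y : Set (Profile N M)) (Ω Φ : ℝ)
    (act : Profile N M → Alloc N M → Alloc N M) : Prop :=
  ∀ y ∈ Y, ∀ ω ∈ paramBall N M R K Ω, ∀ ω' ∈ paramBall N M R K Ω,
    ∑ i, ∑ m, |act y (network ω y) i m - act y (network ω' y) i m| ≤
      Φ * ∑ i, ∑ m, |network ω y i m - network ω' y i m|

/-- For `F`-almost every profile, all utilities under all networks with `‖ω‖₁ ≤ Ω` lie in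
`[1/ψ, ψ]`, and each agent's value of every subset of the resources is at most `1`. -/
def BoundedUtilities {N M : ℕ} (R K : ℕ) (F : Measure (Profile N M)) (Ω ψ : ℝ)
    (act : Profile N M → Alloc N M → Alloc N M) : Prop :=
  ∀ᵐ y ∂F, ∀ i,
    (∀ ω ∈ paramBall N M R K Ω,
      1 / ψ ≤ utility (rpfMechanism act ω y) y.1 y.2.1 i ∧
        utility (rpfMechanism act ω y) y.1 y.2.1 i ≤ ψ) ∧
    ∀ S : Finset (Fin M), ∑ m ∈ S, y.1 i m ≤ 1

/-! ### Generalization errors on a sample `s` of size `L` -/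

def genErrLogNSW {N M L : ℕ} (w : Fin N → ℝ) (F : Measure (Profile N M))
    (f : Profile N M → Alloc N M) (s : Fin L → Profile N M) : ℝ :=
  -(∫ y, logNSW w f y ∂F) + (1 / (L : ℝ)) * ∑ l, logNSW w f (s l)

def genErrExpl {N M L : ℕ} (V D : Set (Alloc N M)) (F : Measure (Profile N M))
    (f : Profile N M → Alloc N M) (i : Fin N) (s : Fin L → Profile N M) : ℝ :=
  (∫ y, expl V D f i y ∂F) - (1 / (L : ℝ)) * ∑ l, expl V D f i (s l)

end

end RPFNet

/-!
Each generalization error is the amount by which the expectation of a loss (the negated welfare, or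
the exploitability of one agent) exceeds its empirical mean. Let `H ≥ 1` bound all the data. Moving
the parameters by `Δ` in `ℓ¹` moves the network output by at most `H (1 + Ω) ^ (R + 1) Δ`, because
the incoming weights of each layer have `ℓ¹` norm at most `Ω`; hence every loss moves by at most
`2 H³ ψ Φ (1 + Ω) ^ (R + 1) Δ`. Comparing volumes, the `ℓ¹` ball of radius `Ω` in `ℝᵈ` has an
`ε`-net of at most `(1 + 2 Ω / ε) ^ d` points, and Hoeffding's inequality with a union bound over
the net and the `N + 1` losses gives a uniform bound. With `A = L N Ω Φ max {K, M N}`, the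
resolution `ε = Ω / A ^ (5 R)` costs only `O(1 / L)` in accuracy, while the logarithm of the number
of events in the union bound is at most `8 R d log A`.
-/

namespace RPFNet

section Covering

open Metric Module
open scoped NNReal

variable {E : Type*} [NormedAddCommGroup E] [NormedSpace ℝ E] [FiniteDimensional ℝ E]

theorem card_le_of_isSeparated {s : Finset E} {x : E} {r : ℝ} {ε : ℝ≥0} (hr : 0 ≤ r) (hε : 0 < ε)
    (hsr : ↑s ⊆ closedBall x r) (hs : IsSeparated ε (s : Set E)) :
    (s.card : ℝ) ≤ (1 + 2 * r / ε) ^ finrank ℝ E := by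
  borelize E
  set μ : Measure E := Measure.addHaar
  have hε2 : (0 : ℝ) < ε / 2 := by positivity
  have real_ball {ρ : ℝ} (hρ : 0 < ρ) (c : E) :
      μ.real (ball c ρ) = ρ ^ finrank ℝ E * μ.real (ball 0 1) := by
    rw [measureReal_def, μ.addHaar_ball_of_pos c hρ, ENNReal.toReal_mul,
      ENNReal.toReal_ofReal (by positivity), measureReal_def]
  have hdisjoint : (s : Set E).PairwiseDisjoint fun c => ball c (ε / 2) := fun c hc c' hc' hne => by
    refine ball_disjoint_ball ?_
    rw [add_halves, ← coe_nndist, NNReal.coe_le_coe]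
    exact (ENNReal.coe_lt_coe.1 ((hs hc hc' hne).trans_eq (edist_nndist c c'))).le
  have hcontained : ⋃ c ∈ s, ball c (ε / 2 : ℝ) ⊆ ball x (r + ε / 2) :=
    Set.iUnion₂_subset fun c hc => ball_subset_ball' (by linarith [mem_closedBall.1 (hsr hc)])
  have hvolume : s.card * ((ε / 2 : ℝ) ^ finrank ℝ E * μ.real (ball 0 1)) ≤
      (r + ε / 2) ^ finrank ℝ E * μ.real (ball 0 1) :=
    calc s.card * ((ε / 2 : ℝ) ^ finrank ℝ E * μ.real (ball 0 1))
        = μ.real (⋃ c ∈ s, ball c (ε / 2 : ℝ)) := by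
          rw [measureReal_biUnion_finset hdisjoint fun _ _ => measurableSet_ball]
          simp only [real_ball hε2, Finset.sum_const, nsmul_eq_mul]
      _ ≤ μ.real (ball x (r + ε / 2)) := measureReal_mono hcontained
      _ = _ := real_ball (by positivity) x
  have hunit : 0 < μ.real (ball (0 : E) 1) :=
    ENNReal.toReal_pos (measure_ball_pos μ 0 one_pos).ne' measure_ball_lt_top.ne
  have hratio : 1 + 2 * r / ε = (r + ε / 2) / (ε / 2) := by field_simp; ring
  rw [hratio, div_pow, le_div_iff₀ (by positivity)]
  exact le_of_mul_le_mul_right (by linarith) hunit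

theorem packingNumber_closedBall_le {x : E} {r : ℝ} {ε : ℝ≥0} (hr : 0 ≤ r) (hε : 0 < ε) :
    packingNumber ε (closedBall x r) ≤ ⌊(1 + 2 * r / ε) ^ finrank ℝ E⌋₊ := by
  refine iSup₂_le fun C hC => iSup_le fun hsep => ?_
  by_contra! hlarge
  obtain ⟨T, hTC, hT⟩ := Set.exists_subset_encard_eq (Order.add_one_le_of_lt hlarge)
  lift T to Finset E using Set.finite_of_encard_le_coe hT.le
  have hcard := Nat.le_floor (card_le_of_isSeparated hr hε (hTC.trans hC) (hsep.mono hTC))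
  rw [Set.encard_coe_eq_coe_finsetCard] at hT
  have : T.card = ⌊(1 + 2 * r / ε) ^ finrank ℝ E⌋₊ + 1 := by exact_mod_cast hT
  omega

theorem exists_finset_isCover_closedBall {x : E} {r : ℝ} {ε : ℝ≥0} (hr : 0 ≤ r) (hε : 0 < ε) :
    ∃ s : Finset E, ↑s ⊆ closedBall x r ∧ IsCover ε (closedBall x r) (s : Set E) ∧
      (s.card : ℝ) ≤ (1 + 2 * r / ε) ^ finrank ℝ E := by
  have hle := (coveringNumber_le_packingNumber ε _).trans
    (packingNumber_closedBall_le (x := x) hr hε)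
  obtain ⟨C, hCr, hfin, hcover, hcard⟩ :=
    exists_set_encard_eq_coveringNumber (hle.trans_lt (ENat.natCast_lt_top _)).ne
  lift C to Finset E using hfin
  rw [← hcard, Set.encard_coe_eq_coe_finsetCard, Nat.cast_le] at hle
  exact ⟨C, hCr, hcover, (Nat.le_floor_iff (by positivity)).1 hle⟩

end Covering

section Deviation

open ProbabilityTheory
open scoped NNReal

variable {α : Type*} [MeasurableSpace α] {F : Measure α} {L : ℕ} {G : Set α} {f g : α → ℝ}
  {a b c t : ℝ}

/-- The one-sided generalization error of `g`: by how much its expectation exceeds its empirical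
mean on the sample `s`. -/
noncomputable def sampleDeviation (F : Measure α) (g : α → ℝ) (s : Fin L → α) : ℝ :=
  (∫ y, g y ∂F) - (1 / (L : ℝ)) * ∑ l, g (s l)

theorem mul_sampleDeviation_eq_sum (hL : 0 < L) (s : Fin L → α) :
    L * sampleDeviation F g s = ∑ l, (∫ y, g y ∂F - g (s l)) := by
  have : (L : ℝ) ≠ 0 := by positivity
  simp only [sampleDeviation, Finset.sum_sub_distrib, Finset.sum_const, Finset.card_univ,
    Fintype.card_fin, nsmul_eq_mul]
  field_simp

theorem measure_le_sampleDeviation_le [IsProbabilityMeasure F] (hL : 0 < L) (hg : AEMeasurable g F)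
    (hgab : ∀ᵐ y ∂F, g y ∈ Set.Icc a b) (ht : 0 ≤ t) :
    Measure.pi (fun _ : Fin L => F) {s | t ≤ sampleDeviation F g s} ≤
      ENNReal.ofReal (Real.exp (-(2 * L * t ^ 2 / (b - a) ^ 2))) := by
  have hsubgaussian (l : Fin L) : HasSubgaussianMGF (fun s : Fin L → α => ∫ y, g y ∂F - g (s l))
      ((‖b - a‖₊ / 2) ^ 2) (Measure.pi fun _ => F) := by
    have hmp := measurePreserving_eval (fun _ : Fin L => F) l
    refine HasSubgaussianMGF.of_map (X := fun y => ∫ y, g y ∂F - g y) hmp.aemeasurable ?_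
    rw [hmp.map_eq]
    simpa only [Pi.neg_def, neg_sub] using (hasSubgaussianMGF_of_mem_Icc hg hgab).neg
  have hindep : iIndepFun (fun (l : Fin L) (s : Fin L → α) => ∫ y, g y ∂F - g (s l))
      (Measure.pi fun _ => F) :=
    iIndepFun_pi (X := fun _ y => ∫ y, g y ∂F - g y) fun _ => hg.const_sub _
  have htail := HasSubgaussianMGF.measure_sum_ge_le_of_iIndepFun hindep
    (s := Finset.univ) (fun l _ => hsubgaussian l) (ε := L * t) (by positivity)
  have hvariance : ((∑ _l : Fin L, (‖b - a‖₊ / 2) ^ 2 : ℝ≥0) : ℝ) = L * ((b - a) ^ 2 / 4) := by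
    simp only [Finset.sum_const, Finset.card_univ, Fintype.card_fin, nsmul_eq_mul]
    push_cast
    rw [Real.norm_eq_abs, div_pow, sq_abs]
    norm_num
  have hexponent : -(L * t) ^ 2 / (2 * (L * ((b - a) ^ 2 / 4))) =
      -(2 * L * t ^ 2 / (b - a) ^ 2) := by
    have : (L : ℝ) ≠ 0 := by positivity
    rcases eq_or_ne ((b - a) ^ 2) 0 with h0 | _
    · simp [h0]
    · field_simp
      ring
  rw [hvariance, hexponent] at htail
  rw [← ofReal_measureReal]
  refine ENNReal.ofReal_le_ofReal (le_of_eq_of_le ?_ htail)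
  congr! 3 with s
  rw [← mul_sampleDeviation_eq_sum hL, mul_le_mul_iff_right₀ (by positivity)]

theorem sampleDeviation_le_add_two_mul [IsProbabilityMeasure F] (hL : 0 < L) {η : ℝ}
    (hf : Integrable f F) (hg : Integrable g F) (hG : ∀ᵐ y ∂F, y ∈ G)
    (hfg : ∀ y ∈ G, |f y - g y| ≤ η) {s : Fin L → α} (hs : ∀ l, s l ∈ G) :
    sampleDeviation F f s ≤ sampleDeviation F g s + 2 * η := by
  have hexpectation : ∫ y, f y ∂F - ∫ y, g y ∂F ≤ η :=
    calc ∫ y, f y ∂F - ∫ y, g y ∂F = ∫ y, (f y - g y) ∂F := (integral_sub hf hg).symm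
      _ ≤ ∫ _, η ∂F := integral_mono_ae (hf.sub hg) (integrable_const η)
          (hG.mono fun y hy => (le_abs_self _).trans (hfg y hy))
      _ = η := by simp
  have hmean : 1 / (L : ℝ) * ∑ l, g (s l) - 1 / (L : ℝ) * ∑ l, f (s l) ≤ η :=
    calc 1 / (L : ℝ) * ∑ l, g (s l) - 1 / (L : ℝ) * ∑ l, f (s l)
        = 1 / (L : ℝ) * ∑ l, (g (s l) - f (s l)) := by
          rw [← mul_sub, Finset.sum_sub_distrib]
      _ ≤ 1 / (L : ℝ) * ∑ _l : Fin L, η := by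
          gcongr with l
          exact (le_abs_self _).trans (abs_sub_comm (g (s l)) _ ▸ hfg _ (hs l))
      _ = η := by simp [field]
  simp only [sampleDeviation]
  linarith

theorem measure_exists_le_sampleDeviation_le [IsProbabilityMeasure F] (hL : 0 < L) {κ : Type*}
    (T : Finset κ) {g : κ → α → ℝ} (hg : ∀ k ∈ T, AEMeasurable (g k) F)
    (hgc : ∀ k ∈ T, ∀ᵐ y ∂F, |g k y| ≤ c) (ht : 0 ≤ t) :
    Measure.pi (fun _ : Fin L => F) {s | ∃ k ∈ T, t ≤ sampleDeviation F (g k) s} ≤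
      ENNReal.ofReal (T.card * Real.exp (-(L * t ^ 2 / (2 * c ^ 2)))) := by
  have hexponent : 2 * L * t ^ 2 / (c - -c) ^ 2 = L * t ^ 2 / (2 * c ^ 2) := by
    rw [sub_neg_eq_add, ← two_mul, mul_pow, mul_assoc, mul_div_mul_comm, div_mul_eq_div_div]
    ring
  calc Measure.pi (fun _ : Fin L => F) {s | ∃ k ∈ T, t ≤ sampleDeviation F (g k) s}
      ≤ ∑ k ∈ T, Measure.pi (fun _ : Fin L => F) {s | t ≤ sampleDeviation F (g k) s} := by
        rw [show {s | ∃ k ∈ T, t ≤ sampleDeviation F (g k) s} =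
          ⋃ k ∈ T, {s : Fin L → α | t ≤ sampleDeviation F (g k) s} by ext; simp]
        exact measure_biUnion_finset_le _ _
    _ ≤ ∑ _k ∈ T, ENNReal.ofReal (Real.exp (-(L * t ^ 2 / (2 * c ^ 2)))) := by
        refine Finset.sum_le_sum fun k hk => ?_
        rw [← hexponent]
        exact measure_le_sampleDeviation_le hL (hg k hk)
          ((hgc k hk).mono fun y hy => abs_le.1 hy) ht
    _ = _ := by
        rw [Finset.sum_const, nsmul_eq_mul, ENNReal.ofReal_mul (Nat.cast_nonneg _),
          ENNReal.ofReal_natCast]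

theorem measure_not_forall_sampleDeviation_le_of_isCover [IsProbabilityMeasure F] (hL : 0 < L)
    {P ι : Type*} [PseudoMetricSpace P] [Fintype ι] {S : Set P} {T : Finset P} {ε Λ : ℝ≥0}
    (hTS : ↑T ⊆ S) (hT : Metric.IsCover ε S (T : Set P)) (hG : ∀ᵐ y ∂F, y ∈ G)
    {g : ι → P → α → ℝ} (hg : ∀ j, ∀ p ∈ S, AEMeasurable (g j p) F)
    (hgc : ∀ j, ∀ p ∈ S, ∀ y ∈ G, |g j p y| ≤ c)
    (hlip : ∀ j, ∀ y ∈ G, LipschitzOnWith Λ (fun p => g j p y) S) (ht : 0 ≤ t) :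
    Measure.pi (fun _ : Fin L => F)
        {s | ¬ ∀ p ∈ S, ∀ j, sampleDeviation F (g j p) s ≤ 2 * (Λ * ε) + t} ≤
      ENNReal.ofReal (Fintype.card ι * T.card * Real.exp (-(L * t ^ 2 / (2 * c ^ 2)))) := by
  have hint (j) {p} (hp : p ∈ S) : Integrable (g j p) F :=
    Integrable.of_bound (hg j p hp).aestronglyMeasurable c (hG.mono (hgc j p hp))
  have hsample : ∀ᵐ s ∂(Measure.pi fun _ : Fin L => F), ∀ l, s l ∈ G :=
    ae_all_iff.2 fun l => (Measure.quasiMeasurePreserving_eval (fun _ : Fin L => F) l).ae hG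
  have hnet := measure_exists_le_sampleDeviation_le hL ((Finset.univ : Finset ι) ×ˢ T)
    (g := fun k => g k.1 k.2) (c := c) (fun k hk => hg _ _ (hTS (Finset.mem_product.1 hk).2))
    (fun k hk => hG.mono (hgc _ _ (hTS (Finset.mem_product.1 hk).2))) ht
  rw [Finset.card_product, Finset.card_univ, Nat.cast_mul] at hnet
  refine (measure_mono_ae ?_).trans hnet
  filter_upwards [hsample] with s hs hlarge
  change ¬ ∀ p ∈ S, ∀ j, sampleDeviation F (g j p) s ≤ 2 * (Λ * ε) + t at hlarge
  push Not at hlarge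
  obtain ⟨p, hp, j, hlt⟩ := hlarge
  obtain ⟨q, hq, hpq⟩ := hT hp
  have hpq : dist p q ≤ ε := NNReal.coe_le_coe.2 (edist_le_coe.1 hpq)
  have hclose : ∀ y ∈ G, |g j p y - g j q y| ≤ Λ * ε := fun y hy =>
    ((hlip j y hy).dist_le_mul p hp q (hTS hq)).trans (by gcongr)
  have := sampleDeviation_le_add_two_mul hL (hint j hp) (hint j (hTS hq)) hG hclose hs
  exact ⟨(j, q), Finset.mem_product.2 ⟨Finset.mem_univ j, hq⟩, by linarith⟩

theorem measure_not_forall_sampleDeviation_le_closedBall [IsProbabilityMeasure F] (hL : 0 < L)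
    {E ι : Type*} [NormedAddCommGroup E] [NormedSpace ℝ E] [FiniteDimensional ℝ E] [Fintype ι]
    {x : E} {r : ℝ} {ε Λ : ℝ≥0} (hr : 0 ≤ r) (hε : 0 < ε) (hG : ∀ᵐ y ∂F, y ∈ G)
    {g : ι → E → α → ℝ} (hg : ∀ j, ∀ p ∈ Metric.closedBall x r, AEMeasurable (g j p) F)
    (hgc : ∀ j, ∀ p ∈ Metric.closedBall x r, ∀ y ∈ G, |g j p y| ≤ c)
    (hlip : ∀ j, ∀ y ∈ G, LipschitzOnWith Λ (fun p => g j p y) (Metric.closedBall x r))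
    (ht : 0 ≤ t) :
    Measure.pi (fun _ : Fin L => F) {s | ¬ ∀ p ∈ Metric.closedBall x r, ∀ j,
        sampleDeviation F (g j p) s ≤ 2 * (Λ * ε) + t} ≤
      ENNReal.ofReal (Fintype.card ι * (1 + 2 * r / ε) ^ Module.finrank ℝ E *
        Real.exp (-(L * t ^ 2 / (2 * c ^ 2)))) := by
  obtain ⟨T, hTS, hT, hcard⟩ := exists_finset_isCover_closedBall (x := x) hr hε
  refine (measure_not_forall_sampleDeviation_le_of_isCover hL hTS hT hG hg hgc hlip ht).trans ?_
  gcongr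

end Deviation

section Network

theorem sum_comp_le_of_injective {α β : Type*} [Fintype α] [Fintype β] {e : α → β}
    (he : Function.Injective e) {f : β → ℝ} (hf : ∀ b, 0 ≤ f b) : ∑ a, f (e a) ≤ ∑ b, f b :=
  (Finset.sum_map Finset.univ ⟨e, he⟩ f).symm.trans_le (Finset.sum_le_univ_sum_of_nonneg hf)

theorem abs_relu_sub_relu_le (a b : ℝ) : |max 0 a - max 0 b| ≤ |a - b| := by
  simpa only [max_comm] using abs_max_sub_max_le_abs a b 0

section Affine

variable {α : Type} [Fintype α] {W W' : Option α → ℝ} {h h' : α → ℝ} {B D : ℝ}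

theorem abs_affine_le (hB : 1 ≤ B) (hh : ∀ j, |h j| ≤ B) : |affine W h| ≤ B * ∑ o, |W o| :=
  calc |affine W h| ≤ |W none| + |∑ j, W (some j) * h j| := abs_add_le _ _
    _ ≤ |W none| + ∑ j, |W (some j)| * |h j| := by
        simp only [← abs_mul]
        gcongr
        exact Finset.abs_sum_le_sum_abs _ _
    _ ≤ B * |W none| + ∑ j, |W (some j)| * B := by
        gcongr with j
        exacts [le_mul_of_one_le_left (abs_nonneg _) hB, hh j]
    _ = B * ∑ o, |W o| := by rw [Fintype.sum_option, ← Finset.sum_mul]; ring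

theorem abs_affine_sub_affine_le (hB : 1 ≤ B) (hh : ∀ j, |h j| ≤ B) (hD : 0 ≤ D)
    (hd : ∀ j, |h j - h' j| ≤ D) :
    |affine W h - affine W' h'| ≤ B * ∑ o, |W o - W' o| + D * ∑ o, |W' o| := by
  have hsplit : affine W h - affine W' h' =
      affine (fun o => W o - W' o) h + ∑ j, W' (some j) * (h j - h' j) := by
    simp only [affine, sub_mul, mul_sub, Finset.sum_sub_distrib]
    ring
  have hinput : |∑ j, W' (some j) * (h j - h' j)| ≤ D * ∑ o, |W' o| :=
    calc |∑ j, W' (some j) * (h j - h' j)| ≤ ∑ j, |W' (some j)| * |h j - h' j| := by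
          simp only [← abs_mul]
          exact Finset.abs_sum_le_sum_abs _ _
      _ ≤ ∑ j, |W' (some j)| * D := by
          gcongr with j
          exact hd j
      _ ≤ D * ∑ o, |W' o| := by
          rw [Fintype.sum_option, ← Finset.sum_mul, mul_comm]
          gcongr
          exact le_add_of_nonneg_left (abs_nonneg _)
  rw [hsplit]
  exact (abs_add_le _ _).trans (add_le_add (abs_affine_le hB hh) hinput)

end Affine

variable {N M R K : ℕ} {Ω Φ H : ℝ} {ω ω' : ParamIdx N M R K → ℝ} {y : Profile N M}

theorem nonneg_of_mem_paramBall (hω : ω ∈ paramBall N M R K Ω) : 0 ≤ Ω :=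
  (Finset.sum_nonneg fun p _ => abs_nonneg (ω p)).trans hω

theorem abs_netInput_le (hv : ∀ i m, |y.1 i m| ≤ H) (hx : ∀ i m, |y.2.1 i m| ≤ H)
    (hb : ∀ m, |y.2.2 m| ≤ H) : ∀ j, |netInput y j| ≤ H
  | Sum.inl p => hv p.1 p.2
  | Sum.inr (Sum.inl p) => hx p.1 p.2
  | Sum.inr (Sum.inr m) => hb m

theorem abs_hidden_le (hH : 1 ≤ H) (hy : ∀ j, |netInput y j| ≤ H)
    (hω : ω ∈ paramBall N M R K Ω) (n : ℕ) (k : Fin K) :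
    |hidden ω y n k| ≤ H * (1 + Ω) ^ (n + 1) := by
  have hΩ := nonneg_of_mem_paramBall hω
  have node_le {α : Type} [Fintype α] {e : Option α → ParamIdx N M R K} {h : α → ℝ} {B : ℝ}
      (he : Function.Injective e) (hB : 1 ≤ B) (hh : ∀ j, |h j| ≤ B) :
      |max 0 (affine (fun o => ω (e o)) h)| ≤ B * (1 + Ω) :=
    calc |max 0 (affine (fun o => ω (e o)) h)| ≤ |affine (fun o => ω (e o)) h| := by
          simpa using abs_relu_sub_relu_le (affine (fun o => ω (e o)) h) 0
      _ ≤ B * ∑ o, |ω (e o)| := abs_affine_le hB hh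
      _ ≤ B * (1 + Ω) := by
          gcongr
          have hnode := (sum_comp_le_of_injective he fun p => abs_nonneg (ω p)).trans hω
          linarith
  induction n generalizing k with
  | zero =>
    rw [hidden, zero_add, pow_one]
    exact node_le (e := fun o => Sum.inl (k, o)) (fun a b h => by simpa using h) hH hy
  | succ n ih =>
    rw [hidden]
    split_ifs with hn
    · rw [pow_succ, ← mul_assoc]
      exact node_le (e := fun o => Sum.inr (Sum.inl (⟨n, hn⟩, k, o)))
        (fun a b h => by simpa using h)
        (one_le_mul_of_one_le_of_one_le hH (one_le_pow₀ (by linarith))) ih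
    · rw [abs_zero]
      positivity

theorem abs_hidden_sub_hidden_le (hH : 1 ≤ H) (hy : ∀ j, |netInput y j| ≤ H)
    (hω : ω ∈ paramBall N M R K Ω) (hω' : ω' ∈ paramBall N M R K Ω) (n : ℕ) (k : Fin K) :
    |hidden ω y n k - hidden ω' y n k| ≤ H * (1 + Ω) ^ (n + 1) * ∑ p, |ω p - ω' p| := by
  have hΩ := nonneg_of_mem_paramBall hω
  set Δ := ∑ p, |ω p - ω' p|
  have : 0 ≤ Δ := Finset.sum_nonneg fun p _ => abs_nonneg _
  have node_sub_le {α : Type} [Fintype α] {e : Option α → ParamIdx N M R K} {h h' : α → ℝ} {B D : ℝ}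
      (he : Function.Injective e) (hB : 1 ≤ B) (hh : ∀ j, |h j| ≤ B) (hD : 0 ≤ D)
      (hd : ∀ j, |h j - h' j| ≤ D) :
      |max 0 (affine (fun o => ω (e o)) h) - max 0 (affine (fun o => ω' (e o)) h')| ≤
        B * Δ + D * Ω := by
    refine (abs_relu_sub_relu_le _ _).trans
      ((abs_affine_sub_affine_le hB hh hD hd).trans ?_)
    gcongr
    · exact sum_comp_le_of_injective he fun p => abs_nonneg (ω p - ω' p)
    · exact (sum_comp_le_of_injective he fun p => abs_nonneg (ω' p)).trans hω'
  induction n generalizing k with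
  | zero =>
    rw [hidden, hidden]
    refine (node_sub_le (e := fun o => Sum.inl (k, o)) (fun a b h => by simpa using h) hH hy le_rfl
      (by simp)).trans ?_
    rw [zero_add, pow_one, zero_mul, add_zero, mul_right_comm]
    exact le_mul_of_one_le_right (by positivity) (by linarith)
  | succ n ih =>
    rw [hidden, hidden]
    split_ifs with hn
    · refine (node_sub_le (e := fun o => Sum.inr (Sum.inl (⟨n, hn⟩, k, o)))
        (fun a b h => by simpa using h)
        (one_le_mul_of_one_le_of_one_le hH (one_le_pow₀ (by linarith)))
        (abs_hidden_le hH hy hω n) (by positivity) ih).trans_eq ?_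
      ring
    · rw [sub_zero, abs_zero]
      positivity

theorem sum_abs_network_sub_network_le (hR : 1 ≤ R) (hH : 1 ≤ H) (hy : ∀ j, |netInput y j| ≤ H)
    (hω : ω ∈ paramBall N M R K Ω) (hω' : ω' ∈ paramBall N M R K Ω) :
    ∑ i, ∑ m, |network ω y i m - network ω' y i m| ≤
      H * (1 + Ω) ^ (R + 1) * ∑ p, |ω p - ω' p| := by
  have hΩ := nonneg_of_mem_paramBall hω
  set Δ := ∑ p, |ω p - ω' p|
  have : 0 ≤ Δ := Finset.sum_nonneg fun p _ => abs_nonneg _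
  obtain ⟨B, hBdef⟩ : ∃ B, B = H * (1 + Ω) ^ (R - 1 + 1) := ⟨_, rfl⟩
  have hB : 1 ≤ B := hBdef ▸ one_le_mul_of_one_le_of_one_le hH (one_le_pow₀ (by linarith))
  let out (q : (Fin N × Fin M) × Option (Fin K)) : ParamIdx N M R K := Sum.inr (Sum.inr q)
  have out_injective : Function.Injective out := fun a b h => by simpa [out] using h
  have houtput : ∑ q, |ω (out q) - ω' (out q)| ≤ Δ :=
    sum_comp_le_of_injective out_injective fun p => abs_nonneg (ω p - ω' p)
  have houtput' : ∑ q, |ω' (out q)| ≤ Ω :=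
    (sum_comp_le_of_injective out_injective fun p => abs_nonneg (ω' p)).trans hω'
  calc ∑ i, ∑ m, |network ω y i m - network ω' y i m|
      ≤ ∑ i, ∑ m, (B * ∑ o, |ω (out ((i, m), o)) - ω' (out ((i, m), o))| +
          B * Δ * ∑ o, |ω' (out ((i, m), o))|) := by
        gcongr with i _ m
        exact abs_affine_sub_affine_le hB (hBdef ▸ abs_hidden_le hH hy hω _) (by positivity)
          (hBdef ▸ abs_hidden_sub_hidden_le hH hy hω hω' _)
    _ = B * ∑ q, |ω (out q) - ω' (out q)| + B * Δ * ∑ q, |ω' (out q)| := by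
        simp only [Fintype.sum_prod_type, Finset.sum_add_distrib, ← Finset.mul_sum]
    _ ≤ B * Δ + B * Δ * Ω := by gcongr
    _ = H * (1 + Ω) ^ (R + 1) * Δ := by rw [hBdef, Nat.sub_add_cancel hR]; ring

theorem sum_abs_rpfMechanism_sub_rpfMechanism_le {Y : Set (Profile N M)}
    {act : Profile N M → Alloc N M → Alloc N M} (hΦ : 0 ≤ Φ)
    (hlip : LipschitzActivation R K Y Ω Φ act) (hR : 1 ≤ R) (hH : 1 ≤ H) (hyY : y ∈ Y)
    (hy : ∀ j, |netInput y j| ≤ H) (hω : ω ∈ paramBall N M R K Ω)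
    (hω' : ω' ∈ paramBall N M R K Ω) :
    ∑ i, ∑ m, |rpfMechanism act ω y i m - rpfMechanism act ω' y i m| ≤
      Φ * (H * (1 + Ω) ^ (R + 1) * ∑ p, |ω p - ω' p|) :=
  (hlip y hyY ω hω ω' hω').trans
    (mul_le_mul_of_nonneg_left (sum_abs_network_sub_network_le hR hH hy hω hω') hΦ)

theorem le_numParams (hM : 1 ≤ M) : N ≤ numParams N M R K := by
  have := Fintype.card_le_of_injective
    (fun i : Fin N => (Sum.inr (Sum.inr ((i, ⟨0, hM⟩), none)) : ParamIdx N M R K))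
    fun a b h => by simpa using h
  simpa only [numParams, Fintype.card_fin] using this

theorem mem_paramBall_iff_toLp_mem_closedBall :
    ω ∈ paramBall N M R K Ω ↔ WithLp.toLp 1 ω ∈ Metric.closedBall 0 Ω := by
  simp [paramBall, PiLp.norm_eq_of_L1]

end Network

section Objectives

variable {N M : ℕ} {c ψ H W e : ℝ}

section Utility

variable {a a' v x : Alloc N M} {i : Fin N}

theorem utility_nonneg (hv : ∀ m, 0 ≤ v i m) (hx : ∀ m, 0 ≤ x i m) (ha : ∀ m, 0 ≤ a i m) :
    0 ≤ utility a v x i :=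
  Finset.sum_nonneg fun m _ => mul_nonneg (hv m) (le_min (ha m) (hx m))

theorem utility_le (hc : 0 ≤ c) (hv : ∀ m, 0 ≤ v i m) (hv1 : ∑ m, v i m ≤ 1)
    (hx : ∀ m, x i m ≤ c) : utility a v x i ≤ c :=
  calc utility a v x i ≤ ∑ m, v i m * c := Finset.sum_le_sum fun m _ =>
        mul_le_mul_of_nonneg_left ((min_le_right _ _).trans (hx m)) (hv m)
    _ = (∑ m, v i m) * c := (Finset.sum_mul _ _ _).symm
    _ ≤ c := mul_le_of_le_one_left hc hv1

theorem abs_utility_sub_utility_le (hv : ∀ m, |v i m| ≤ c) :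
    |utility a v x i - utility a' v x i| ≤ c * ∑ m, |a i m - a' i m| := by
  rw [utility, utility, ← Finset.sum_sub_distrib, Finset.mul_sum]
  refine (Finset.abs_sum_le_sum_abs _ _).trans (Finset.sum_le_sum fun m _ => ?_)
  rw [← mul_sub, abs_mul]
  exact mul_le_mul (hv m) (by simpa using abs_min_sub_min_le_max (a i m) (x i m) (a' i m) (x i m))
    (abs_nonneg _) ((abs_nonneg _).trans (hv m))

end Utility

theorem abs_log_sub_log_le {m a b : ℝ} (hm : 0 < m) (ha : m ≤ a) (hb : m ≤ b) :
    |Real.log a - Real.log b| ≤ |a - b| / m := by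
  have log_sub_log_le {a b : ℝ} (ha : m ≤ a) (hb : m ≤ b) :
      Real.log a - Real.log b ≤ |a - b| / m := by
    have ha0 := hm.trans_le ha
    have hb0 := hm.trans_le hb
    calc Real.log a - Real.log b = Real.log (a / b) := (Real.log_div ha0.ne' hb0.ne').symm
      _ ≤ a / b - 1 := Real.log_le_sub_one_of_pos (div_pos ha0 hb0)
      _ = (a - b) / b := by rw [sub_div, div_self hb0.ne']
      _ ≤ |a - b| / m := div_le_div₀ (abs_nonneg _) (le_abs_self _) hm hb
  exact abs_sub_le_iff.2 ⟨log_sub_log_le ha hb, abs_sub_comm a b ▸ log_sub_log_le hb ha⟩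

theorem abs_log_le_log_add {u : ℝ} (hψ : 1 ≤ ψ) (hu : 1 / ψ ≤ u) (huc : u ≤ c) :
    |Real.log u| ≤ Real.log ψ + c := by
  have hψ0 : 0 < ψ := one_pos.trans_le hψ
  have hu0 : 0 < u := (one_div_pos.2 hψ0).trans_le hu
  have hlower : -Real.log ψ ≤ Real.log u := by
    rw [← Real.log_inv, ← one_div]
    exact Real.log_le_log (one_div_pos.2 hψ0) hu
  have hupper : Real.log u ≤ c := by linarith [Real.log_le_sub_one_of_pos hu0]
  exact abs_le.2 ⟨by linarith, by linarith [Real.log_nonneg hψ]⟩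

section Welfare

variable {w : Fin N → ℝ} {f f' : Profile N M → Alloc N M} {y : Profile N M}

theorem logNSW_eq_sum (hu : ∀ i, 0 < utility (f y) y.1 y.2.1 i) :
    logNSW w f y = ∑ i, w i * Real.log (utility (f y) y.1 y.2.1 i) := by
  rw [logNSW, NSW, Real.log_prod fun i _ => (Real.rpow_pos_of_pos (hu i) _).ne']
  exact Finset.sum_congr rfl fun i _ => Real.log_rpow (hu i) _

theorem abs_logNSW_le (hψ : 1 ≤ ψ) (hw : ∀ i, |w i| ≤ W)
    (hu : ∀ i, utility (f y) y.1 y.2.1 i ∈ Set.Icc (1 / ψ) c) :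
    |logNSW w f y| ≤ N * (W * (Real.log ψ + c)) := by
  have hψ0 : 0 < 1 / ψ := by positivity
  rw [logNSW_eq_sum fun i => hψ0.trans_le (hu i).1]
  refine (Finset.abs_sum_le_sum_abs _ _).trans ((Finset.sum_le_card_nsmul _ _
    (W * (Real.log ψ + c)) fun i _ => ?_).trans_eq (by simp))
  rw [abs_mul]
  exact mul_le_mul (hw i) (abs_log_le_log_add hψ (hu i).1 (hu i).2) (abs_nonneg _)
    ((abs_nonneg _).trans (hw i))

theorem abs_logNSW_sub_logNSW_le (hψ : 0 < ψ) (hw : ∀ i, |w i| ≤ W) (hv : ∀ i m, |y.1 i m| ≤ c)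
    (hu : ∀ i, 1 / ψ ≤ utility (f y) y.1 y.2.1 i)
    (hu' : ∀ i, 1 / ψ ≤ utility (f' y) y.1 y.2.1 i) :
    |logNSW w f y - logNSW w f' y| ≤ W * c * ψ * ∑ i, ∑ m, |f y i m - f' y i m| := by
  have hψ0 : 0 < 1 / ψ := by positivity
  rw [logNSW_eq_sum fun i => hψ0.trans_le (hu i), logNSW_eq_sum fun i => hψ0.trans_le (hu' i),
    ← Finset.sum_sub_distrib, Finset.mul_sum]
  refine (Finset.abs_sum_le_sum_abs _ _).trans (Finset.sum_le_sum fun i _ => ?_)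
  rw [← mul_sub, abs_mul]
  have hlog := abs_log_sub_log_le hψ0 (hu i) (hu' i)
  rw [div_div_eq_mul_div, div_one] at hlog
  calc _ ≤ W * (c * (∑ m, |f y i m - f' y i m|) * ψ) := by
        gcongr
        · exact (abs_nonneg _).trans (hw i)
        · exact hw i
        · exact hlog.trans (by gcongr; exact abs_utility_sub_utility_le (hv i))
    _ = _ := by ring

end Welfare

/-- The utilities that agent `i` can obtain from its own misreports at the profile `y`: `expl` is
the supremum of this set minus the utility of the truthful report. -/
def misreportUtilities (V D : Set (Alloc N M)) (f : Profile N M → Alloc N M) (i : Fin N)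
    (y : Profile N M) : Set ℝ :=
  {t | ∃ v' x' : Fin M → ℝ, Function.update y.1 i v' ∈ V ∧ Function.update y.2.1 i x' ∈ D ∧
    t = utility (f (misreport y i v' x')) y.1 y.2.1 i}

/-- The functions of a profile whose sample deviations are the generalization errors: the negated
welfare (`none`) and the exploitability of each agent `i` (`some i`). -/
noncomputable def loss (V D : Set (Alloc N M)) (w : Fin N → ℝ) (f : Profile N M → Alloc N M) :
    Option (Fin N) → Profile N M → ℝ
  | none, y => -logNSW w f y
  | some i, y => expl V D f i y

variable {V D : Set (Alloc N M)} {B : Set (Fin M → ℝ)} {f f' : Profile N M → Alloc N M}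
  {w : Fin N → ℝ} {y : Profile N M} {i : Fin N}

theorem expl_eq_sSup_misreportUtilities_sub (V D : Set (Alloc N M)) (f : Profile N M → Alloc N M)
    (i : Fin N) (y : Profile N M) :
    expl V D f i y = sSup (misreportUtilities V D f i y) - utility (f y) y.1 y.2.1 i :=
  rfl

theorem misreport_mem (hy : y ∈ V ×ˢ D ×ˢ B) {v' x' : Fin M → ℝ}
    (hv : Function.update y.1 i v' ∈ V) (hx : Function.update y.2.1 i x' ∈ D) :
    misreport y i v' x' ∈ V ×ˢ D ×ˢ B :=
  ⟨hv, hx, hy.2.2⟩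

theorem utility_mem_misreportUtilities (hy : y ∈ V ×ˢ D ×ˢ B) :
    utility (f y) y.1 y.2.1 i ∈ misreportUtilities V D f i y :=
  ⟨y.1 i, y.2.1 i, by simpa using hy.1, by simpa using hy.2.1, by simp [misreport]⟩

theorem misreportUtilities_subset_Icc (hy : y ∈ V ×ˢ D ×ˢ B) (hf : ∀ y' ∈ V ×ˢ D ×ˢ B, 0 ≤ f y')
    (hv : ∀ m, 0 ≤ y.1 i m) (hv1 : ∑ m, y.1 i m ≤ 1) (hc : 0 ≤ c)
    (hx : ∀ m, y.2.1 i m ∈ Set.Icc 0 c) : misreportUtilities V D f i y ⊆ Set.Icc 0 c := by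
  rintro t ⟨v', x', hv', hx', rfl⟩
  exact ⟨utility_nonneg hv (fun m => (hx m).1) (hf _ (misreport_mem hy hv' hx') i),
    utility_le hc hv hv1 fun m => (hx m).2⟩

theorem abs_expl_le (hy : y ∈ V ×ˢ D ×ˢ B) (hf : misreportUtilities V D f i y ⊆ Set.Icc 0 c) :
    |expl V D f i y| ≤ c := by
  have htruthful := hf (utility_mem_misreportUtilities hy)
  have hsup : sSup (misreportUtilities V D f i y) ∈ Set.Icc 0 c :=
    ⟨Real.sSup_nonneg fun t ht => (hf ht).1,
      csSup_le ⟨_, utility_mem_misreportUtilities hy⟩ fun t ht => (hf ht).2⟩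
  rw [expl_eq_sSup_misreportUtilities_sub]
  exact abs_sub_le_iff.2 ⟨by linarith [hsup.2, htruthful.1], by linarith [hsup.1, htruthful.2]⟩

theorem sSup_misreportUtilities_le_add (hy : y ∈ V ×ˢ D ×ˢ B)
    (hf' : BddAbove (misreportUtilities V D f' i y))
    (he : ∀ y' ∈ V ×ˢ D ×ˢ B,
      |utility (f y') y.1 y.2.1 i - utility (f' y') y.1 y.2.1 i| ≤ e) :
    sSup (misreportUtilities V D f i y) ≤ sSup (misreportUtilities V D f' i y) + e := by
  refine csSup_le ⟨_, utility_mem_misreportUtilities hy⟩ ?_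
  rintro t ⟨v', x', hv', hx', rfl⟩
  have := le_csSup hf' ⟨v', x', hv', hx', rfl⟩
  linarith [(abs_le.1 (he _ (misreport_mem hy hv' hx'))).2]

theorem abs_expl_sub_expl_le (hy : y ∈ V ×ˢ D ×ˢ B)
    (hf : BddAbove (misreportUtilities V D f i y))
    (hf' : BddAbove (misreportUtilities V D f' i y))
    (he : ∀ y' ∈ V ×ˢ D ×ˢ B,
      |utility (f y') y.1 y.2.1 i - utility (f' y') y.1 y.2.1 i| ≤ e) :
    |expl V D f i y - expl V D f' i y| ≤ 2 * e := by
  have hsup := sSup_misreportUtilities_le_add hy hf' he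
  have hsup' := sSup_misreportUtilities_le_add hy hf fun y' hy' =>
    (abs_sub_comm _ _).trans_le (he y' hy')
  have htruthful := abs_le.1 (he y hy)
  rw [expl_eq_sSup_misreportUtilities_sub, expl_eq_sSup_misreportUtilities_sub]
  exact abs_le.2 ⟨by linarith, by linarith⟩

theorem abs_loss_le (hH : 1 ≤ H) (hψ : 1 ≤ ψ) (hw : ∀ i, |w i| ≤ H) (hy : y ∈ V ×ˢ D ×ˢ B)
    (hv : ∀ i m, 0 ≤ y.1 i m) (hx : ∀ i m, y.2.1 i m ∈ Set.Icc 0 H)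
    (hv1 : ∀ i, ∑ m, y.1 i m ≤ 1) (hf : ∀ y' ∈ V ×ˢ D ×ˢ B, 0 ≤ f y')
    (hu : ∀ i, 1 / ψ ≤ utility (f y) y.1 y.2.1 i) (j : Option (Fin N)) :
    |loss V D w f j y| ≤ H ^ 2 * N * (1 + Real.log ψ) := by
  have hH0 : 0 ≤ H := zero_le_one.trans hH
  have hlog := Real.log_nonneg hψ
  have hHH : H ≤ H ^ 2 := le_self_pow₀ hH two_ne_zero
  cases j with
  | none =>
    calc |-logNSW w f y| ≤ N * (H * (Real.log ψ + H)) := by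
          rw [abs_neg]
          exact abs_logNSW_le hψ hw fun i =>
            ⟨hu i, utility_le hH0 (hv i) (hv1 i) fun m => (hx i m).2⟩
      _ = N * (H * Real.log ψ + H ^ 2) := by ring
      _ ≤ N * (H ^ 2 * Real.log ψ + H ^ 2) := by gcongr
      _ = H ^ 2 * N * (1 + Real.log ψ) := by ring
  | some i =>
    have hN : (1 : ℝ) ≤ N := by exact_mod_cast i.pos
    calc |expl V D f i y| ≤ H :=
          abs_expl_le hy (misreportUtilities_subset_Icc hy hf (hv i) (hv1 i) hH0 (hx i))
      _ ≤ H ^ 2 * 1 * (1 + 0) := by linarith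
      _ ≤ H ^ 2 * N * (1 + Real.log ψ) := by gcongr

theorem abs_loss_sub_loss_le (hH : 1 ≤ H) (hψ : 1 ≤ ψ) (hw : ∀ i, |w i| ≤ H)
    (hy : y ∈ V ×ˢ D ×ˢ B) (hv : ∀ i m, y.1 i m ∈ Set.Icc 0 H)
    (hx : ∀ i m, y.2.1 i m ∈ Set.Icc 0 H) (hv1 : ∀ i, ∑ m, y.1 i m ≤ 1)
    (hf : ∀ y' ∈ V ×ˢ D ×ˢ B, 0 ≤ f y') (hf' : ∀ y' ∈ V ×ˢ D ×ˢ B, 0 ≤ f' y')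
    (hu : ∀ i, 1 / ψ ≤ utility (f y) y.1 y.2.1 i)
    (hu' : ∀ i, 1 / ψ ≤ utility (f' y) y.1 y.2.1 i)
    (he : ∀ y' ∈ V ×ˢ D ×ˢ B, ∑ i, ∑ m, |f y' i m - f' y' i m| ≤ e) (j : Option (Fin N)) :
    |loss V D w f j y - loss V D w f' j y| ≤ 2 * H ^ 2 * ψ * e := by
  have hH0 : 0 ≤ H := zero_le_one.trans hH
  have he0 : 0 ≤ e := (by positivity : 0 ≤ ∑ i, ∑ m, |f y i m - f' y i m|).trans (he y hy)
  have hvabs (i m) : |y.1 i m| ≤ H := (abs_of_nonneg (hv i m).1).trans_le (hv i m).2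
  cases j with
  | none =>
    calc |-logNSW w f y - -logNSW w f' y| = |logNSW w f y - logNSW w f' y| := by
          rw [neg_sub_neg, abs_sub_comm]
      _ ≤ H * H * ψ * ∑ i, ∑ m, |f y i m - f' y i m| :=
          abs_logNSW_sub_logNSW_le (by linarith) hw hvabs hu hu'
      _ ≤ H * H * ψ * e := by gcongr; exact he y hy
      _ ≤ 2 * H ^ 2 * ψ * e := by linarith [(by positivity : 0 ≤ H * H * ψ * e)]
  | some i =>
    have hbdd {g : Profile N M → Alloc N M} (hg : ∀ y' ∈ V ×ˢ D ×ˢ B, 0 ≤ g y') :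
        BddAbove (misreportUtilities V D g i y) :=
      bddAbove_Icc.mono
        (misreportUtilities_subset_Icc hy hg (fun m => (hv i m).1) (hv1 i) hH0 (hx i))
    have hutility (y') (hy' : y' ∈ V ×ˢ D ×ˢ B) :
        |utility (f y') y.1 y.2.1 i - utility (f' y') y.1 y.2.1 i| ≤ H * e := by
      refine (abs_utility_sub_utility_le (hvabs i)).trans ?_
      gcongr
      exact (Finset.single_le_sum (f := fun i => ∑ m, |f y' i m - f' y' i m|)
        (fun i _ => by positivity) (Finset.mem_univ i)).trans (he y' hy')
    calc |expl V D f i y - expl V D f' i y| ≤ 2 * (H * e) :=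
          abs_expl_sub_expl_le hy (hbdd hf) (hbdd hf') hutility
      _ = 2 * (H * 1) * 1 * e := by ring
      _ ≤ 2 * (H * H) * ψ * e := by gcongr
      _ = 2 * H ^ 2 * ψ * e := by ring

end Objectives

section Calibration

variable {A L X ψ δ : ℝ} {N R d : ℕ}

theorem lipschitz_mul_resolution_le {Ω Φ : ℝ} (hR : 1 ≤ R) (hA : 2 ≤ A) (hL : 0 < L) (hΩ : 0 ≤ Ω)
    (hΩA : Ω ≤ A) (hΦ : 0 ≤ Φ) (hLA : L * Ω * Φ ≤ A) :
    Φ * (1 + Ω) ^ (R + 1) * (Ω / A ^ (5 * R)) ≤ 1 / L := by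
  have hA1 : 1 ≤ A := by linarith
  have hpow : (1 + Ω) ^ (R + 1) ≤ A ^ (4 * R) :=
    calc (1 + Ω) ^ (R + 1) ≤ (A ^ 2) ^ (R + 1) := by gcongr; nlinarith
      _ = A ^ (2 * (R + 1)) := (pow_mul _ _ _).symm
      _ ≤ A ^ (4 * R) := pow_le_pow_right₀ hA1 (by omega)
  rw [le_div_iff₀ hL]
  calc Φ * (1 + Ω) ^ (R + 1) * (Ω / A ^ (5 * R)) * L
      = (1 + Ω) ^ (R + 1) * (L * Ω * Φ) / A ^ (5 * R) := by ring
    _ ≤ A ^ (4 * R) * A / A ^ (5 * R) := by gcongr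
    _ = A ^ (4 * R + 1) / A ^ (5 * R) := by rw [pow_succ]
    _ ≤ 1 := div_le_one_of_le₀ (pow_le_pow_right₀ hA1 (by omega)) (by positivity)

theorem covering_bound_le_exp (hR : 1 ≤ R) (hA : 2 ≤ A) (hNd : N ≤ d) :
    (N + 1) * (1 + 2 * A ^ (5 * R)) ^ d ≤ Real.exp (8 * (R * d * Real.log A)) := by
  have hA0 : 0 < A := by linarith
  have hA1 : 1 ≤ A := by linarith
  have hN : (N + 1 : ℝ) ≤ A ^ (R * d) :=
    calc (N + 1 : ℝ) ≤ 2 ^ N := by exact_mod_cast Nat.lt_two_pow_self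
      _ ≤ A ^ N := by gcongr
      _ ≤ A ^ (R * d) := pow_le_pow_right₀ hA1 (hNd.trans (Nat.le_mul_of_pos_left d hR))
  have hbase : 1 + 2 * A ^ (5 * R) ≤ A ^ (7 * R) :=
    calc 1 + 2 * A ^ (5 * R) ≤ 2 ^ 2 * A ^ (5 * R) := by
          linarith [one_le_pow₀ hA1 (n := 5 * R)]
      _ ≤ A ^ 2 * A ^ (5 * R) := by gcongr
      _ = A ^ (2 + 5 * R) := (pow_add _ _ _).symm
      _ ≤ A ^ (7 * R) := pow_le_pow_right₀ hA1 (by omega)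
  calc (N + 1) * (1 + 2 * A ^ (5 * R)) ^ d ≤ A ^ (R * d) * (A ^ (7 * R)) ^ d := by gcongr
    _ = A ^ (8 * (R * d)) := by ring
    _ = Real.exp (8 * (R * d * Real.log A)) := by
        rw [← Real.exp_log (pow_pos hA0 _), Real.log_pow]
        push_cast
        ring_nf

theorem exp_mul_exp_deviation_le {c : ℝ} (hX : 0 ≤ X) (hL : 0 < L) (hc : 0 < c) (hδ : 0 < δ)
    (hδ1 : δ ≤ 1) :
    Real.exp (8 * X) * Real.exp (-(L * (c * (4 * Real.sqrt (X / L) +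
      2 * Real.sqrt (Real.log (1 / δ) / L))) ^ 2 / (2 * c ^ 2))) ≤ δ := by
  have hlog : 0 ≤ Real.log (1 / δ) := Real.log_nonneg ((one_le_div hδ).2 hδ1)
  set a := Real.sqrt (X / L)
  set b := Real.sqrt (Real.log (1 / δ) / L)
  have ha : L * a ^ 2 = X := by rw [Real.sq_sqrt (by positivity)]; field_simp
  have hb : L * b ^ 2 = Real.log (1 / δ) := by rw [Real.sq_sqrt (by positivity)]; field_simp
  have hab : 0 ≤ L * (a * b) := by positivity
  have hsquare : L * (c * (4 * a + 2 * b)) ^ 2 / (2 * c ^ 2) =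
      8 * (L * a ^ 2) + 8 * (L * (a * b)) + 2 * (L * b ^ 2) := by
    field_simp
    ring
  calc _ = Real.exp (-(8 * (L * (a * b)) + 2 * Real.log (1 / δ))) := by
        rw [← Real.exp_add, hsquare, ha, hb]
        ring_nf
    _ ≤ Real.exp (-Real.log (1 / δ)) := Real.exp_le_exp.2 (by linarith)
    _ = δ := by rw [one_div, Real.log_inv, neg_neg, Real.exp_log hδ]

theorem one_div_le_two_mul_sqrt (hX : 1 / 2 ≤ X) (hL : 1 ≤ L) : 1 / L ≤ 2 * Real.sqrt (X / L) := by
  have hroot : 1 / (2 * L) ≤ Real.sqrt (X / L) := by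
    apply Real.le_sqrt_of_sq_le
    rw [div_pow, div_le_div_iff₀ (by positivity) (by positivity)]
    nlinarith [mul_nonneg (sub_nonneg.2 hX) (sq_nonneg L)]
  calc 1 / L = 2 * (1 / (2 * L)) := by field_simp
    _ ≤ _ := by gcongr

theorem resolution_add_deviation_le {H n r a b : ℝ} (hH : 1 ≤ H) (hψ : 1 ≤ ψ) (hn : 1 ≤ n)
    (hra : r ≤ 2 * a) (ha : 0 ≤ a) (hb : 0 ≤ b) :
    2 * (2 * H ^ 3 * ψ * r) + H ^ 2 * n * (1 + Real.log ψ) * (4 * a + 2 * b) ≤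
      12 * H ^ 3 * (ψ * n * a + (1 + Real.log ψ) * n * b) := by
  have hlog := Real.log_nonneg hψ
  have hlogψ : 1 + Real.log ψ ≤ ψ := by linarith [Real.log_le_sub_one_of_pos (one_pos.trans_le hψ)]
  have hHH : H ^ 2 ≤ H ^ 3 := pow_le_pow_right₀ hH (by norm_num)
  have hresolution : 2 * (2 * H ^ 3 * ψ * r) ≤ 8 * H ^ 3 * (ψ * n * a) :=
    calc 2 * (2 * H ^ 3 * ψ * r) = 4 * H ^ 3 * (ψ * 1) * r := by ring
      _ ≤ 4 * H ^ 3 * (ψ * 1) * (2 * a) := by gcongr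
      _ ≤ 4 * H ^ 3 * (ψ * n) * (2 * a) := by gcongr
      _ = 8 * H ^ 3 * (ψ * n * a) := by ring
  have hcomplexity : H ^ 2 * n * (1 + Real.log ψ) * (4 * a) ≤ H ^ 3 * n * ψ * (4 * a) := by gcongr
  have hconfidence : H ^ 2 * n * (1 + Real.log ψ) * (2 * b) ≤
      H ^ 3 * n * (1 + Real.log ψ) * (12 * b) := by
    gcongr
    norm_num
  linarith

theorem failure_probability_le {Ω c : ℝ} (hR : 1 ≤ R) (hA : 2 ≤ A) (hNd : N ≤ d) (hL : 0 < L)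
    (hΩ : 0 < Ω) (hc : 0 < c) (hδ : 0 < δ) (hδ1 : δ ≤ 1) :
    (N + 1) * (1 + 2 * Ω / (Ω / A ^ (5 * R))) ^ d *
      Real.exp (-(L * (c * (4 * Real.sqrt (R * d * Real.log A / L) +
        2 * Real.sqrt (Real.log (1 / δ) / L))) ^ 2 / (2 * c ^ 2))) ≤ δ := by
  have hratio : 2 * Ω / (Ω / A ^ (5 * R)) = 2 * A ^ (5 * R) := by field_simp
  have hlog : 0 ≤ Real.log A := Real.log_nonneg (by linarith)
  rw [hratio]
  exact (mul_le_mul_of_nonneg_right (covering_bound_le_exp hR hA hNd) (Real.exp_nonneg _)).trans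
    (exp_mul_exp_deviation_le (by positivity) hL hc hδ hδ1)

theorem deviation_bound_le {Ω Φ H n b : ℝ} (hR : 1 ≤ R) (hH : 1 ≤ H) (hψ : 1 ≤ ψ) (hn : 1 ≤ n)
    (hA : 2 ≤ A) (hL : 1 ≤ L) (hΩ : 0 ≤ Ω) (hΩA : Ω ≤ A) (hΦ : 0 ≤ Φ) (hLA : L * Ω * Φ ≤ A)
    (hd : 1 ≤ d) (hb : 0 ≤ b) :
    2 * (2 * H ^ 3 * ψ * (Φ * (1 + Ω) ^ (R + 1)) * (Ω / A ^ (5 * R))) +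
        H ^ 2 * n * (1 + Real.log ψ) * (4 * Real.sqrt (R * d * Real.log A / L) + 2 * b) ≤
      12 * H ^ 3 * (ψ * n * Real.sqrt (R * d * Real.log A / L) +
        (1 + Real.log ψ) * n * b) := by
  have hX : 1 / 2 ≤ R * d * Real.log A :=
    calc (1 / 2 : ℝ) ≤ 1 * 1 * Real.log 2 := by linarith [Real.log_two_gt_d9]
      _ ≤ R * d * Real.log A := by gcongr <;> exact_mod_cast ‹_›
  refine (add_le_add_left ?_ _).trans (resolution_add_deviation_le hH hψ hn
    (one_div_le_two_mul_sqrt hX hL) (Real.sqrt_nonneg _) hb)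
  rw [mul_assoc (2 * H ^ 3 * ψ)]
  gcongr
  exact lipschitz_mul_resolution_le hR hA (by linarith) hΩ hΩA hΦ hLA

theorem pos_and_pos_and_pos_of_mul_pos {L N : ℕ} {Ω Φ k : ℝ} (hΦ : 0 ≤ Φ) (hk : 0 ≤ k)
    (h : 0 < L * N * Ω * Φ * k) : 0 < L ∧ 0 < N ∧ 0 < Ω := by
  have hLNΩ : 0 < L * N * Ω :=
    pos_of_mul_pos_left (pos_of_mul_pos_left h hk) hΦ
  have hΩ : 0 < Ω := pos_of_mul_pos_right hLNΩ (by positivity)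
  have hLN : 0 < L * N := by exact_mod_cast pos_of_mul_pos_left hLNΩ hΩ.le
  exact ⟨Nat.pos_of_mul_pos_right hLN, Nat.pos_of_mul_pos_left hLN, hΩ⟩

theorem le_and_mul_le_of_one_le {l n Ω Φ k : ℝ} (hl : 1 ≤ l) (hn : 1 ≤ n) (hΩ : 0 ≤ Ω) (hΦ : 1 ≤ Φ)
    (hk : 1 ≤ k) : Ω ≤ l * n * Ω * Φ * k ∧ l * Ω * Φ ≤ l * n * Ω * Φ * k := by
  have hlarger : l * Ω * Φ ≤ l * n * Ω * Φ * k :=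
    calc l * Ω * Φ = l * 1 * Ω * Φ * 1 := by ring
      _ ≤ l * n * Ω * Φ * k := by gcongr
  refine ⟨le_trans ?_ hlarger, hlarger⟩
  calc Ω = 1 * Ω * 1 := by ring
    _ ≤ l * Ω * Φ := by gcongr

end Calibration

section Generalization

open scoped NNReal

variable {N M R K L : ℕ} {H Ω Φ ψ t : ℝ} {V D : Set (Alloc N M)} {B : Set (Fin M → ℝ)}
  {Y : Set (Profile N M)} {w : Fin N → ℝ} {act : Profile N M → Alloc N M → Alloc N M}
  {y : Profile N M} {F : Measure (Profile N M)}

/-- The profiles in `Y` at which every network with `‖ω‖₁ ≤ Ω` gives every agent a utility of at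
least `1/ψ`, and at which no agent's total value of the resources exceeds `1`. -/
def regularProfiles (Y : Set (Profile N M)) (R K : ℕ) (Ω ψ : ℝ)
    (act : Profile N M → Alloc N M → Alloc N M) : Set (Profile N M) :=
  {y | y ∈ Y ∧ ∀ i, (∀ ω ∈ paramBall N M R K Ω,
    1 / ψ ≤ utility (rpfMechanism act ω y) y.1 y.2.1 i) ∧ ∑ m, y.1 i m ≤ 1}

theorem pos_of_mem_regularProfiles (hy : y ∈ regularProfiles Y R K Ω ψ act) (hΩ : 0 ≤ Ω)
    (hψ : 0 < ψ) (hN : 0 < N) : 0 < M := by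
  have hzero : (0 : ParamIdx N M R K → ℝ) ∈ paramBall N M R K Ω := by simpa [paramBall] using hΩ
  have hutility := (one_div_pos.2 hψ).trans_le ((hy.2 ⟨0, hN⟩).1 0 hzero)
  by_contra! hM
  obtain rfl := Nat.le_zero.1 hM
  simp [utility] at hutility

theorem abs_loss_rpfMechanism_le (hH : 1 ≤ H) (hψ : 1 ≤ ψ) (hw : ∀ i, |w i| ≤ H)
    (hV : ∀ v ∈ V, ∀ i m, 0 ≤ v i m) (hD : ∀ x ∈ D, ∀ i m, x i m ∈ Set.Icc 0 H)
    (hact : ∀ y ∈ V ×ˢ D ×ˢ B, ∀ z, 0 ≤ act y z)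
    (hy : y ∈ regularProfiles (V ×ˢ D ×ˢ B) R K Ω ψ act)
    {ω : ParamIdx N M R K → ℝ} (hω : ω ∈ paramBall N M R K Ω) (j : Option (Fin N)) :
    |loss V D w (rpfMechanism act ω) j y| ≤ H ^ 2 * N * (1 + Real.log ψ) :=
  abs_loss_le hH hψ hw hy.1 (hV _ hy.1.1) (hD _ hy.1.2.1) (fun i => (hy.2 i).2)
    (fun y' hy' => hact y' hy' _) (fun i => (hy.2 i).1 ω hω) j

theorem abs_loss_rpfMechanism_sub_le (hR : 1 ≤ R) (hH : 1 ≤ H) (hψ : 1 ≤ ψ) (hΦ : 0 ≤ Φ)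
    (hV : ∀ v ∈ V, ∀ i m, v i m ∈ Set.Icc 0 H) (hD : ∀ x ∈ D, ∀ i m, x i m ∈ Set.Icc 0 H)
    (hB : ∀ b ∈ B, ∀ m, |b m| ≤ H) (hw : ∀ i, |w i| ≤ H)
    (hact : ∀ y ∈ V ×ˢ D ×ˢ B, ∀ z, 0 ≤ act y z)
    (hlip : LipschitzActivation R K (V ×ˢ D ×ˢ B) Ω Φ act)
    (hy : y ∈ regularProfiles (V ×ˢ D ×ˢ B) R K Ω ψ act) {ω ω' : ParamIdx N M R K → ℝ}
    (hω : ω ∈ paramBall N M R K Ω) (hω' : ω' ∈ paramBall N M R K Ω) (j : Option (Fin N)) :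
    |loss V D w (rpfMechanism act ω) j y - loss V D w (rpfMechanism act ω') j y| ≤
      2 * H ^ 3 * ψ * (Φ * (1 + Ω) ^ (R + 1)) * ∑ p, |ω p - ω' p| := by
  have abs_le {u : ℝ} (hu : u ∈ Set.Icc 0 H) : |u| ≤ H := (abs_of_nonneg hu.1).trans_le hu.2
  refine (abs_loss_sub_loss_le hH hψ hw hy.1 (hV _ hy.1.1) (hD _ hy.1.2.1) (fun i => (hy.2 i).2)
    (fun y' hy' => hact y' hy' _) (fun y' hy' => hact y' hy' _) (fun i => (hy.2 i).1 ω hω)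
    (fun i => (hy.2 i).1 ω' hω') (fun y' hy' => sum_abs_rpfMechanism_sub_rpfMechanism_le hΦ hlip
      hR hH hy' (abs_netInput_le (fun i m => abs_le (hV _ hy'.1 i m))
        (fun i m => abs_le (hD _ hy'.2.1 i m)) (hB _ hy'.2.2)) hω hω') j).trans_eq ?_
  ring

theorem measure_not_forall_sampleDeviation_loss_le [IsProbabilityMeasure F] (hL : 0 < L)
    (hR : 1 ≤ R) (hH : 1 ≤ H) (hψ : 1 ≤ ψ) (hΩ : 0 ≤ Ω) (hΦ : 0 ≤ Φ)
    (hV : ∀ v ∈ V, ∀ i m, v i m ∈ Set.Icc 0 H) (hD : ∀ x ∈ D, ∀ i m, x i m ∈ Set.Icc 0 H)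
    (hB : ∀ b ∈ B, ∀ m, |b m| ≤ H) (hw : ∀ i, |w i| ≤ H)
    (hact : ∀ y ∈ V ×ˢ D ×ˢ B, ∀ z, 0 ≤ act y z)
    (hlip : LipschitzActivation R K (V ×ˢ D ×ˢ B) Ω Φ act)
    (hF : ∀ᵐ y ∂F, y ∈ regularProfiles (V ×ˢ D ×ˢ B) R K Ω ψ act)
    (hmeas : ∀ ω ∈ paramBall N M R K Ω, ∀ j, AEMeasurable (loss V D w (rpfMechanism act ω) j) F)
    {ε : ℝ} (hε : 0 < ε) (ht : 0 ≤ t) :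
    Measure.pi (fun _ : Fin L => F) {s | ¬ ∀ ω ∈ paramBall N M R K Ω, ∀ j,
        sampleDeviation F (loss V D w (rpfMechanism act ω) j) s ≤
          2 * (2 * H ^ 3 * ψ * (Φ * (1 + Ω) ^ (R + 1)) * ε) + t} ≤
      ENNReal.ofReal ((N + 1) * (1 + 2 * Ω / ε) ^ numParams N M R K *
        Real.exp (-(L * t ^ 2 / (2 * (H ^ 2 * N * (1 + Real.log ψ)) ^ 2)))) := by
  lift ε to ℝ≥0 using hε.le
  obtain ⟨Λ, hΛ⟩ : ∃ Λ : ℝ≥0, (Λ : ℝ) = 2 * H ^ 3 * ψ * (Φ * (1 + Ω) ^ (R + 1)) :=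
    CanLift.prf _ (by positivity)
  have hball {p : PiLp 1 fun _ : ParamIdx N M R K => ℝ} (hp : p ∈ Metric.closedBall 0 Ω) :
      WithLp.ofLp p ∈ paramBall N M R K Ω := mem_paramBall_iff_toLp_mem_closedBall.2 hp
  have hdim : Module.finrank ℝ (PiLp 1 fun _ : ParamIdx N M R K => ℝ) = numParams N M R K :=
    (WithLp.linearEquiv 1 ℝ _).finrank_eq.trans (Module.finrank_fintype_fun_eq_card ℝ)
  have hconc := measure_not_forall_sampleDeviation_le_closedBall (L := L) hL
    (x := (0 : PiLp 1 fun _ : ParamIdx N M R K => ℝ)) (ε := ε) (Λ := Λ) hΩ (by exact_mod_cast hε) hF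
    (g := fun j p => loss V D w (rpfMechanism act (WithLp.ofLp p)) j)
    (fun j p hp => hmeas _ (hball hp) j)
    (fun j p hp y hy => abs_loss_rpfMechanism_le hH hψ hw (fun v hv i m => (hV v hv i m).1) hD hact
      hy (hball hp) j)
    (fun j y hy => LipschitzOnWith.of_dist_le_mul fun p hp q hq => by
      rw [PiLp.dist_eq_of_L1, hΛ]
      exact abs_loss_rpfMechanism_sub_le hR hH hψ hΦ hV hD hB hw hact hlip hy (hball hp)
        (hball hq) j) ht
  rw [hdim, hΛ, Fintype.card_option, Fintype.card_fin, Nat.cast_succ] at hconc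
  refine (measure_mono (Set.ofPred_subset_ofPred.2 fun s => mt fun hball ω hω => ?_)).trans hconc
  exact hball (WithLp.toLp 1 ω) (mem_paramBall_iff_toLp_mem_closedBall.1 hω)

theorem genErrLogNSW_eq_sampleDeviation (f : Profile N M → Alloc N M) (s : Fin L → Profile N M) :
    genErrLogNSW w F f s = sampleDeviation F (loss V D w f none) s := by
  simp only [genErrLogNSW, sampleDeviation, loss, integral_neg, Finset.sum_neg_distrib, mul_neg,
    sub_neg_eq_add]

theorem genErrExpl_eq_sampleDeviation (f : Profile N M → Alloc N M) (i : Fin N)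
    (s : Fin L → Profile N M) :
    genErrExpl V D F f i s = sampleDeviation F (loss V D w f (some i)) s :=
  rfl

theorem max_genErr_le_of_sampleDeviation_loss_le {f : Profile N M → Alloc N M}
    {s : Fin L → Profile N M} {ε : ℝ} (hs : ∀ j, sampleDeviation F (loss V D w f j) s ≤ ε)
    (i : Fin N) : max (genErrLogNSW w F f s) (genErrExpl V D F f i s) ≤ ε :=
  max_le ((genErrLogNSW_eq_sampleDeviation f s).trans_le (hs none))
    ((genErrExpl_eq_sampleDeviation f i s).trans_le (hs (some i)))

end Generalization

end RPFNet

open RPFNet in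
theorem mainTheorem3_general {N M R K L : ℕ} {H Ω Φ ψ δ : ℝ} {V D : Set (Alloc N M)}
    {B : Set (Fin M → ℝ)} {w : Fin N → ℝ} {act : Profile N M → Alloc N M → Alloc N M}
    {F : Measure (Profile N M)} [IsProbabilityMeasure F] (hR : 1 ≤ R) (hH : 1 ≤ H) (hψ : 1 ≤ ψ)
    (hΦ : 1 ≤ Φ) (hA : 2 ≤ L * N * Ω * Φ * max (K : ℝ) (M * N))
    (hV : ∀ v ∈ V, ∀ i m, v i m ∈ Set.Icc 0 H) (hD : ∀ x ∈ D, ∀ i m, x i m ∈ Set.Icc 0 H)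
    (hB : ∀ b ∈ B, ∀ m, |b m| ≤ H) (hw : ∀ i, |w i| ≤ H)
    (hact : ∀ y ∈ V ×ˢ D ×ˢ B, ∀ z, 0 ≤ act y z)
    (hlip : LipschitzActivation R K (V ×ˢ D ×ˢ B) Ω Φ act)
    (hF : ∀ᵐ y ∂F, y ∈ V ×ˢ D ×ˢ B)
    (hu : ∀ᵐ y ∂F, ∀ i, (∀ ω ∈ paramBall N M R K Ω,
      1 / ψ ≤ utility (rpfMechanism act ω y) y.1 y.2.1 i) ∧ ∑ m, y.1 i m ≤ 1)
    (hmeas : ∀ ω ∈ paramBall N M R K Ω, AEMeasurable (logNSW w (rpfMechanism act ω)) F ∧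
      ∀ i, AEMeasurable (expl V D (rpfMechanism act ω) i) F)
    (hδ : 0 < δ) (hδ1 : δ ≤ 1) :
    Measure.pi (fun _ : Fin L => F) {s | ¬ ∀ ω ∈ paramBall N M R K Ω, ∀ i : Fin N,
        max (genErrLogNSW w F (rpfMechanism act ω) s)
            (genErrExpl V D F (rpfMechanism act ω) i s) ≤
          12 * H ^ 3 * (ψ * N * Real.sqrt (R * numParams N M R K *
                Real.log (L * N * Ω * Φ * max (K : ℝ) (M * N)) / L) +
              (1 + Real.log ψ) * N * Real.sqrt (Real.log (1 / δ) / L))} ≤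
      ENNReal.ofReal δ := by
  obtain ⟨hL, hN, hΩ⟩ := pos_and_pos_and_pos_of_mul_pos (by linarith) (by positivity)
    (two_pos.trans_le hA)
  have hreg : ∀ᵐ y ∂F, y ∈ regularProfiles (V ×ˢ D ×ˢ B) R K Ω ψ act := hF.and hu
  have hM : 1 ≤ M :=
    have ⟨_, hy⟩ := hreg.exists
    pos_of_mem_regularProfiles hy hΩ.le (by linarith) hN
  have hNd : N ≤ numParams N M R K := le_numParams hM
  have hk : 1 ≤ max (K : ℝ) (M * N) :=
    le_max_of_le_right (by exact_mod_cast one_le_mul_of_one_le_of_one_le hM hN)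
  have hlogψ := Real.log_nonneg hψ
  obtain ⟨hΩA, hLA⟩ :=
    le_and_mul_le_of_one_le (Nat.one_le_cast.2 hL) (Nat.one_le_cast.2 hN) hΩ.le hΦ hk
  set A := L * N * Ω * Φ * max (K : ℝ) (M * N)
  have hloss (ω) (hω : ω ∈ paramBall N M R K Ω) : ∀ j,
      AEMeasurable (loss V D w (rpfMechanism act ω) j) F
    | none => (hmeas ω hω).1.neg
    | some i => (hmeas ω hω).2 i
  have hconc := measure_not_forall_sampleDeviation_loss_le hL hR hH hψ hΩ.le
    (by linarith) hV hD hB hw hact hlip hreg hloss (ε := Ω / A ^ (5 * R))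
    (t := H ^ 2 * N * (1 + Real.log ψ) * (4 * Real.sqrt (R * numParams N M R K * Real.log A / L) +
      2 * Real.sqrt (Real.log (1 / δ) / L))) (by positivity) (by positivity)
  refine (measure_mono (Set.ofPred_subset_ofPred.2 fun s => mt fun hdev ω hω i => ?_)).trans
    (hconc.trans (ENNReal.ofReal_le_ofReal
      (failure_probability_le hR hA hNd (by exact_mod_cast hL) hΩ (by positivity) hδ hδ1)))
  exact max_genErr_le_of_sampleDeviation_loss_le (fun j => (hdev ω hω j).trans
    (deviation_bound_le hR hH hψ (by exact_mod_cast hN) hA (by exact_mod_cast hL) hΩ.le hΩA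
      (by linarith) hLA (hN.trans_le hNd) (Real.sqrt_nonneg _))) i

theorem mainTheorem3 (vbar dbar bbar wbar : ℝ) :
    ∃ C : ℝ, 0 < C ∧
      ∀ (N M R K L : ℕ), 1 ≤ R → 1 ≤ K → 1 ≤ L →
      -- values, demands, budgets and agent weights
      ∀ (vlow dlow : ℝ), 0 < vlow → 0 < dlow →
      ∀ (V D : Set (RPFNet.Alloc N M)) (B : Set (Fin M → ℝ)),
        (∀ v ∈ V, ∀ i m, v i m ∈ Set.Icc vlow vbar) →
        (∀ x ∈ D, ∀ i m, x i m ∈ Set.Icc dlow dbar) →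
        (∀ b ∈ B, ∀ m, b m ∈ Set.Icc 0 bbar) →
      ∀ w : Fin N → ℝ, (∀ i, w i ∈ Set.Icc 0 wbar) →
      -- the distribution of the profiles
      ∀ (F : MeasureTheory.Measure (RPFNet.Profile N M)) [MeasureTheory.IsProbabilityMeasure F],
        (∀ᵐ y ∂F, y ∈ V ×ˢ D ×ˢ B) →
      -- the regularized proportional fairness activation and its constants
      ∀ (act : RPFNet.Profile N M → RPFNet.Alloc N M → RPFNet.Alloc N M) (Ω Φ ψ : ℝ),
        1 < ψ → 1 ≤ Φ → 2 ≤ L * N * Ω * Φ * max (K : ℝ) (M * N) →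
        RPFNet.IsRPFActivation w (V ×ˢ D ×ˢ B) act →
        RPFNet.LipschitzActivation R K (V ×ˢ D ×ˢ B) Ω Φ act →
        RPFNet.BoundedUtilities R K F Ω ψ act →
        -- the expectations are those of measurable functions
        (∀ ω ∈ RPFNet.paramBall N M R K Ω,
          AEMeasurable (RPFNet.logNSW w (RPFNet.rpfMechanism act ω)) F ∧
          ∀ i, AEMeasurable (RPFNet.expl V D (RPFNet.rpfMechanism act ω) i) F) →
      ∀ δ : ℝ, 0 < δ → δ < 1 →
        MeasureTheory.Measure.pi (fun _ : Fin L => F)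
          {s | ¬ ∀ ω ∈ RPFNet.paramBall N M R K Ω, ∀ i : Fin N,
            max (RPFNet.genErrLogNSW w F (RPFNet.rpfMechanism act ω) s)
                (RPFNet.genErrExpl V D F (RPFNet.rpfMechanism act ω) i s) ≤
              C * (ψ * N * Real.sqrt (R * RPFNet.numParams N M R K *
                      Real.log (L * N * Ω * Φ * max (K : ℝ) (M * N)) / L) +
                (1 + Real.log ψ) * N * Real.sqrt (Real.log (1 / δ) / L))}
          ≤ ENNReal.ofReal δ := by
  obtain ⟨H, hH, hvbar, hdbar, hbbar, hwbar⟩ :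
      ∃ H : ℝ, 1 ≤ H ∧ vbar ≤ H ∧ dbar ≤ H ∧ bbar ≤ H ∧ wbar ≤ H :=
    ⟨max 1 (max vbar (max dbar (max bbar wbar))), by simp⟩
  have abs_le {u hi : ℝ} (hhi : hi ≤ H) (hu : u ∈ Set.Icc 0 hi) : |u| ≤ H :=
    (abs_of_nonneg hu.1).trans_le (hu.2.trans hhi)
  refine ⟨12 * H ^ 3, by positivity, fun N M R K L hR _ _ vlow dlow hvlow hdlow V D B hV hD hB w hw
    F _ hF act Ω Φ ψ hψ hΦ hA hact hlip hu hmeas δ hδ hδ1 => ?_⟩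
  refine mainTheorem3_general hR hH hψ.le hΦ hA
    (fun v hv i m => Set.Icc_subset_Icc hvlow.le hvbar (hV v hv i m))
    (fun x hx i m => Set.Icc_subset_Icc hdlow.le hdbar (hD x hx i m))
    (fun b hb m => abs_le hbbar (hB b hb m)) (fun i => abs_le hwbar (hw i))
    (fun y hy z i m => ((hact y hy z).1.1 i m).1) hlip hF ?_ hmeas hδ hδ1.le
  exact hu.mono fun y hy i => ⟨fun ω hω => ((hy i).1 ω hω).1, (hy i).2 Finset.univ⟩
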